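/- Let $\Sigma\in\mathbb R^{p\times p}$ be symmetric positive definite, $\mu\in\mathbb R^p$, and let $Y^{(1)},Y^{(2)},\dots$ be independent random vectors, each distributed according to the multivariate normal distribution $\mathcal N_p(\mu,\Sigma)$. For every pair $1\le i<j\le p$ let $C(i,j)\subseteq\{1,\dots,p\}\setminus\{i,j\}$. For a covariance matrix $A$, the partial correlation of the $i$th and $j$th variable given those in $C=C(i,j)$ is $-\kappa^{ij}/\sqrt{\kappa^{ii}\kappa^{jj}}$, where $(\kappa^{uv})$ is the inverse of the $(C\cup\{i,j\})\times(C\cup\{i,j\})$ submatrix of $A$. Let $\rho=(\rho_{ij\cdot C(i,j)})_{i<j}$ be the vector of these partial correlations for $A=\Sigma$, and let $r=r^{(n)}=(r_{ij\cdot C(i,j)})_{i<j}$ be the vector of sample partial correlations, computed from the sample covariance matrix $S=\frac1{n-1}\sum_{m=1}^n(Y^{(m)}-\bar Y)(Y^{(m)}-\bar Y)^t$, $\bar Y=\frac1n\sum_{m=1}^nY^{(m)}$. Let $z(x)=\frac12\ln\frac{1+x}{1-x}$ be Fisher's $z$-transform, applied component-wise. A positive semidefinite matrix $A$ is called the asymptotic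 covariance matrix of a sequence of random vectors $T_n$ estimating $\theta$ if $\sqrt n\,(T_n-\theta)\xrightarrow{d}\mathcal N(0,A)$ as $n\to\infty$. Then the components of $\rho$ lie in $(-1,1)$, and the vector $r$ of sample partial correlations (as an estimator of $\rho$) has a unique asymptotic covariance matrix $\Omega=(\omega_{ij,kl})$; its diagonal entries are $\omega_{ij,ij}=(1-\rho_{ij\cdot C(i,j)}^2)^2>0$. The vector $z(r)$ of $z$-transformed sample partial correlations (as an estimator of $z(\rho)$) also has a unique asymptotic covariance matrix, namely the correlation matrix of $\Omega$, that is, the matrix with entries $\omega_{ij,kl}/\sqrt{\omega_{ij,ij}\,\omega_{kl,kl}}$. -/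

import Mathlib

open MeasureTheory ProbabilityTheory Filter Topology

namespace GaussianPartialCorr

/-- The pairs `(i, j)` with `i < j` of elements of `{1, …, p}` (here: of `Fin p`). -/
abbrev Pair (p : ℕ) : Type := {a : Fin p × Fin p // a.1 < a.2}

section

variable {V : Type*} [DecidableEq V]

/-- The concentration (precision) matrix of the variables in `T`: the inverse of the
`T × T` submatrix of `A`. -/
noncomputable def marginalPrecision (A : Matrix V V ℝ) (T : Finset V) : Matrix T T ℝ :=
  (A.submatrix (fun t : T => (t : V)) (fun t : T => (t : V)))⁻¹

/-- The partial correlation of the `i`th and `j`th variable given the variables in `C`, computed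
from the covariance matrix `A`: with `κ` the inverse of the `(C ∪ {i, j}) × (C ∪ {i, j})` submatrix
of `A`, this is `- κ i j / √(κ i i * κ j j)`. -/
noncomputable def partialCorr (A : Matrix V V ℝ) (C : Finset V) (i j : V) : ℝ :=
  let κ := marginalPrecision A (insert i (insert j C))
  let i' : ↥(insert i (insert j C)) := ⟨i, by simp⟩
  let j' : ↥(insert i (insert j C)) := ⟨j, by simp⟩;
  (-κ i' j') / √(κ i' i' * κ j' j')

/-- The sample mean vector of the first `n` terms of the sequence `y`. -/
noncomputable def sampleMean (n : ℕ) (y : ℕ → EuclideanSpace ℝ V) (i : V) : ℝ :=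
  (1 / (n : ℝ)) * ∑ m ∈ Finset.range n, y m i

/-- The sample covariance matrix of the first `n` terms of the sequence `y`. -/
noncomputable def sampleCov (n : ℕ) (y : ℕ → EuclideanSpace ℝ V) : Matrix V V ℝ :=
  Matrix.of fun i j =>
    (1 / ((n : ℝ) - 1)) *
      ∑ m ∈ Finset.range n, (y m i - sampleMean n y i) * (y m j - sampleMean n y j)

end

/-- Fisher's `z`-transform (of interest for `r ∈ (-1, 1)`). -/
noncomputable def fisherZ (r : ℝ) : ℝ := (1 / 2) * Real.log ((1 + r) / (1 - r))

/-- The vector of all partial correlations `ρ_{ij·C(i,j)}`, `i < j`, computed from the covariance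
matrix `A`. -/
noncomputable def partialCorrVec {p : ℕ} (A : Matrix (Fin p) (Fin p) ℝ)
    (C : Pair p → Finset (Fin p)) : EuclideanSpace ℝ (Pair p) :=
  WithLp.toLp 2 fun a => partialCorr A (C a) a.1.1 a.1.2

/-- The component-wise `z`-transform of a vector. -/
noncomputable def fisherZVec {ι : Type*} (r : EuclideanSpace ℝ ι) : EuclideanSpace ℝ ι :=
  WithLp.toLp 2 fun a => fisherZ (r a)

/-- The correlation matrix of a covariance matrix `A`. -/
noncomputable def corrMatrix {ι : Type*} (A : Matrix ι ι ℝ) : Matrix ι ι ℝ :=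
  Matrix.of fun a b => A a b / √(A a a * A b b)

/-- The positive semidefinite matrix `A` is the asymptotic covariance matrix of the sequence of
random vectors `T n` as estimators of `θ`: `√n (T n - θ)` converges in distribution to the
centered multivariate normal distribution with covariance matrix `A`. -/
def IsAsymptoticCov {ι : Type*} [Fintype ι] [DecidableEq ι] {Ω : Type*} [MeasurableSpace Ω]
    (P : Measure Ω) [IsProbabilityMeasure P] (T : ℕ → Ω → EuclideanSpace ℝ ι)
    (θ : EuclideanSpace ℝ ι) (A : Matrix ι ι ℝ) : Prop :=
  A.PosSemidef ∧
    TendstoInDistribution (fun (n : ℕ) (ω : Ω) => √(n : ℝ) • (T n ω - θ)) atTop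
      (id : EuclideanSpace ℝ ι → EuclideanSpace ℝ ι) (fun _ => P) (multivariateGaussian 0 A)

end GaussianPartialCorr

open GaussianPartialCorr

/-! Partial correlations do not change when the covariance matrix is scaled, so `r` is a fixed
function of the averages of the first and second order monomials in `Y - μ`
(`partialCorr_sampleCov`). These averages obey the central limit theorem and the strong law, and the
delta method (`IsAsymptoticCov.comp`) carries the Gaussian limit first to `r` and then to `z(r)`.
Uniqueness holds because a positive semidefinite matrix is recovered from its centered Gaussian law.

The diagonal entries come from the derivative of one partial correlation at the true moments. Since
dκ = -κ (dA) κ, its value on the monomials of `x` is `U V + (ρ/2) (U² + V²)`, where `U` and `V` are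
the coordinates `i` and `j` of `κ x`, scaled to variance one
(`exists_hasFDerivAt_neg_div_sqrt_marginalPrecision`). Under the Gaussian law they have covariance
`-ρ`, and splitting into the independent variables `U + V` and `U - V` gives the variance `(1 -
ρ²)²` (`variance_mul_sub_of_hasGaussianLaw`).

Finally `z'(ρ) = 1 / (1 - ρ²)` is the reciprocal of that standard deviation, so the `z`-transform
rescales `Ω` exactly to its correlation matrix. -/

namespace GaussianPartialCorr

open scoped RealInnerProductSpace

/-! ### Fourth moments of real Gaussians. -/

section FourthMoment

/-- Differentiation keeps the shape `q · exp (v t² / 2)` and sends `q` to `q' + v t q`; iterating it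
computes derivatives of the Gaussian moment generating function. -/
lemma deriv_exp_half_mul_sq (v t : ℝ) (q : ℝ → ℝ) (q' : ℝ) (hq : HasDerivAt q q' t) :
    HasDerivAt (fun s => q s * Real.exp (v * s ^ 2 / 2))
      ((q' + v * t * q t) * Real.exp (v * t ^ 2 / 2)) t := by
  have h : HasDerivAt (fun s : ℝ => v * s ^ 2 / 2) (v * t) t := by
    have := ((hasDerivAt_pow 2 t).const_mul v).div_const 2
    convert! this using 1
    simp; ring
  convert! hq.mul h.exp using 1
  ring

/-- The fourth moment of a centered real Gaussian measure. -/
lemma integral_pow_four_gaussianReal (v : NNReal) :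
    ∫ x, x ^ 4 ∂(gaussianReal 0 v) = 3 * (v : ℝ) ^ 2 := by
  have hm : mgf id (gaussianReal 0 v) = fun t => Real.exp (v * t ^ 2 / 2) := by
    ext t
    rw [mgf_gaussianReal (by simp : Measure.map id (gaussianReal 0 v) = gaussianReal 0 v)]
    simp
  have h := iteratedDeriv_mgf_zero (X := id) (μ := gaussianReal 0 v) (by simp) 4
  simp only [Pi.pow_apply, id] at h
  rw [← h]
  change iteratedDeriv 4 (mgf id (gaussianReal 0 v)) 0 = _
  rw [hm]
  have e1 : deriv (fun t : ℝ => Real.exp (v * t ^ 2 / 2))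
      = fun t => (v * t) * Real.exp (v * t ^ 2 / 2) := by
    ext t
    have := (deriv_exp_half_mul_sq v t (fun _ => 1) 0 (hasDerivAt_const _ _)).deriv
    simpa using this
  have e2 : deriv (fun t : ℝ => (v * t) * Real.exp (v * t ^ 2 / 2))
      = fun t => (v + v ^ 2 * t ^ 2) * Real.exp (v * t ^ 2 / 2) := by
    ext t
    have h0 : HasDerivAt (fun t : ℝ => v * t) v t := by
      simpa using (hasDerivAt_id t).const_mul (v : ℝ)
    rw [(deriv_exp_half_mul_sq v t _ _ h0).deriv]
    ring
  have e3 : deriv (fun t : ℝ => (v + v ^ 2 * t ^ 2) * Real.exp (v * t ^ 2 / 2))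
      = fun t => (3 * v ^ 2 * t + v ^ 3 * t ^ 3) * Real.exp (v * t ^ 2 / 2) := by
    ext t
    have h0 := ((hasDerivAt_pow 2 t).const_mul ((v : ℝ) ^ 2)).const_add (v : ℝ)
    rw [(deriv_exp_half_mul_sq v t _ _ h0).deriv]
    push_cast
    ring
  have e4 : deriv (fun t : ℝ => (3 * v ^ 2 * t + v ^ 3 * t ^ 3) * Real.exp (v * t ^ 2 / 2)) 0
      = 3 * (v : ℝ) ^ 2 := by
    have h0 := ((hasDerivAt_id (0 : ℝ)).const_mul (3 * (v : ℝ) ^ 2)).add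
      ((hasDerivAt_pow 3 (0 : ℝ)).const_mul ((v : ℝ) ^ 3))
    have := (deriv_exp_half_mul_sq v 0 _ _ h0).deriv
    simpa using this
  rw [iteratedDeriv_succ, iteratedDeriv_succ, iteratedDeriv_succ, iteratedDeriv_one, e1, e2, e3,
    e4]

/-- The variance of the square of a centered real Gaussian random variable. -/
lemma variance_sq_of_hasLaw_gaussianReal {Ω : Type*} [MeasurableSpace Ω] {P : Measure Ω}
    {X : Ω → ℝ} {v : NNReal} (hX : HasLaw X (gaussianReal 0 v) P) :
    Var[fun ω => X ω ^ 2; P] = 2 * (v : ℝ) ^ 2 := by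
  have h1 : Var[fun ω => X ω ^ 2; P] = Var[fun x => x ^ 2; gaussianReal 0 v] := by
    rw [← hX.map_eq, variance_map (by fun_prop) hX.aemeasurable]
    rfl
  have h4 : MemLp (fun x : ℝ => x ^ 2) 2 (gaussianReal 0 v) := by
    have := memLp_id_gaussianReal' (μ := 0) (v := v) 4 (by simp)
    rw [memLp_two_iff_integrable_sq (by fun_prop)]
    have := this.integrable_norm_pow (by simp)
    refine this.congr (ae_of_all _ fun x => ?_)
    simp only [id, Real.norm_eq_abs]
    rw [← pow_mul]
    exact Even.pow_abs (by decide) x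
  have h2 : ∫ x, x ^ 2 ∂(gaussianReal 0 v) = v := by
    have := variance_eq_sub (μ := gaussianReal 0 v) (X := id) (memLp_id_gaussianReal' 2 (by simp))
    simp only [variance_id_gaussianReal, id] at this
    simpa using this.symm
  rw [h1, variance_eq_sub h4, h2]
  have : ∫ x, ((fun x : ℝ => x ^ 2) ^ 2) x ∂(gaussianReal 0 v) = 3 * (v : ℝ) ^ 2 := by
    rw [← integral_pow_four_gaussianReal]
    refine integral_congr_ae (ae_of_all _ fun x => ?_)
    simp only [Pi.pow_apply]
    ring
  rw [this]
  ring

end FourthMoment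

/-! ### The multivariate central limit theorem. -/

section CentralLimit

variable {Ω : Type*} [MeasurableSpace Ω] {P : Measure Ω} [IsProbabilityMeasure P]
  {E : Type*} [NormedAddCommGroup E] [InnerProductSpace ℝ E] [FiniteDimensional ℝ E]
  [MeasurableSpace E] [BorelSpace E]

/-- The central limit theorem in a finite-dimensional inner product space. -/
theorem tendstoInDistribution_sqrt_smul_sampleMean_sub {ξ : ℕ → Ω → E} (hindep : iIndepFun ξ P)
    (hident : ∀ i, IdentDistrib (ξ i) (ξ 0) P P) (hL2 : MemLp (ξ 0) 2 P)
    (ν : Measure E) [IsGaussian ν] (hν : ∫ x, x ∂ν = 0)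
    (hcov : covarianceBilin ν = covarianceBilin (P.map (ξ 0))) :
    TendstoInDistribution
      (fun (n : ℕ) ω => √(n : ℝ) • ((n : ℝ)⁻¹ • ∑ k ∈ Finset.range n, ξ k ω - ∫ ω, ξ 0 ω ∂P))
      atTop (id : E → E) (fun _ => P) ν := by
  have mξ n := (hident n).aemeasurable_fst
  have hmeas : ∀ n : ℕ, AEMeasurable (fun ω => √(n : ℝ) • ((n : ℝ)⁻¹ •
      ∑ k ∈ Finset.range n, ξ k ω - ∫ ω, ξ 0 ω ∂P)) P := fun n => by fun_prop
  -- The Cramér–Wold device: the characteristic function at `t` is that of the real projection `⟪·,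
  -- t⟫` at 1, to which the one-dimensional theorem applies.
  refine ⟨hmeas, aemeasurable_id, ProbabilityMeasure.tendsto_iff_tendsto_charFun.2 fun t => ?_⟩
  have hident' : ∀ i, IdentDistrib (fun ω => ⟪ξ i ω, t⟫) (fun ω => ⟪ξ 0 ω, t⟫) P P := fun i =>
    (hident i).comp (u := fun x => ⟪x, t⟫) (by fun_prop)
  have hclt := tendstoInDistribution_inv_sqrt_mul_sum_sub (P := P)
    (X := fun k ω => ⟪ξ k ω, t⟫)
    (Y := id) (P' := gaussianReal 0 (Var[fun ω => ⟪ξ 0 ω, t⟫; P]).toNNReal)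
    HasLaw.id (hL2.inner_const t)
    (hindep.comp (fun _ x => ⟪x, t⟫) (fun _ => by fun_prop)) hident'
  have h1 := ProbabilityMeasure.tendsto_iff_tendsto_charFun.1 hclt.tendsto 1
  have hlim : charFun (Measure.map id ν) t
      = charFun (Measure.map id (gaussianReal 0 (Var[fun ω => ⟪ξ 0 ω, t⟫; P]).toNNReal)) 1 := by
    have hid : MemLp id 2 (P.map (ξ 0)) :=
      (memLp_map_measure_iff (by fun_prop) (mξ 0)).2 hL2
    have : IsProbabilityMeasure (P.map (ξ 0)) := Measure.isProbabilityMeasure_map (mξ 0)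
    rw [Measure.map_id, Measure.map_id, charFun_gaussianReal, IsGaussian.charFun_eq', hcov,
      covarianceBilin_self hid, variance_map (by fun_prop) (mξ 0)]
    have e : (fun u => ⟪t, u⟫) ∘ ξ 0 = fun ω => ⟪ξ 0 ω, t⟫ := by
      ext ω
      simp [real_inner_comm]
    rw [e]
    simp [hν, variance_nonneg]
  simp only [ProbabilityMeasure.coe_mk] at h1 ⊢
  rw [hlim]
  refine h1.congr fun n => ?_
  rw [charFun_apply, charFun_apply, integral_map (hclt.forall_aemeasurable n) (by fun_prop),
    integral_map (hmeas n) (by fun_prop)]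
  refine integral_congr_ae (ae_of_all _ fun ω => ?_)
  have hint : ∫ ω, ⟪ξ 0 ω, t⟫ ∂P = ⟪∫ ω, ξ 0 ω ∂P, t⟫ := by
    have := integral_inner (𝕜 := ℝ) (hL2.integrable (by simp)) t
    simp_rw [real_inner_comm t]
    rw [← this]
  have key : (√(n : ℝ))⁻¹ * (∑ k ∈ Finset.range n, ⟪ξ k ω, t⟫ - n * ∫ ω, ⟪ξ 0 ω, t⟫ ∂P)
      = ⟪√(n : ℝ) • ((n : ℝ)⁻¹ • ∑ k ∈ Finset.range n, ξ k ω - ∫ ω, ξ 0 ω ∂P), t⟫ := by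
    rw [hint, real_inner_smul_left, inner_sub_left, real_inner_smul_left, sum_inner]
    rcases Nat.eq_zero_or_pos n with rfl | hn
    · simp
    · have hn' : (0 : ℝ) < n := by exact_mod_cast hn
      have hs := Real.sq_sqrt hn'.le
      have hs0 := Real.sqrt_pos.2 hn'
      field_simp
      rw [hs]
  simp only
  rw [← key]
  simp

end CentralLimit

/-! ### Asymptotic covariance: existence for means, uniqueness, delta method. -/

section AsymptoticCov

lemma posSemidef_covariance {ι Ω : Type*} [Fintype ι] [MeasurableSpace Ω]
    {P : Measure Ω} [IsProbabilityMeasure P] {X : ι → Ω → ℝ} (hX : ∀ i, MemLp (X i) 2 P) :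
    (Matrix.of fun i j => cov[X i, X j; P]).PosSemidef := by
  refine Matrix.PosSemidef.of_dotProduct_mulVec_nonneg ?_ fun x => ?_
  · ext i j
    simp [covariance_comm]
  · have h := covarianceBilin_apply_pi hX (WithLp.toLp 2 x) (WithLp.toLp 2 x)
    have h0 := covarianceBilin_self_nonneg
      (μ := P.map (fun ω => WithLp.toLp 2 fun i => X i ω)) (WithLp.toLp 2 x)
    rw [h] at h0
    refine h0.trans_eq ?_
    simp only [dotProduct, Matrix.mulVec, Finset.mul_sum, Matrix.of_apply, Pi.star_apply,
      star_trivial]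
    refine Finset.sum_congr rfl fun i _ => Finset.sum_congr rfl fun j _ => by ring

variable {ι κ : Type*} [Fintype ι] [DecidableEq ι] [Fintype κ] [DecidableEq κ]
  {Ω : Type*} [MeasurableSpace Ω] {P : Measure Ω} [IsProbabilityMeasure P]

lemma covarianceBilin_multivariateGaussian_covariance (m : EuclideanSpace ℝ ι)
    {ξ : Ω → EuclideanSpace ℝ ι} (hξ : MemLp ξ 2 P) :
    covarianceBilin (multivariateGaussian m
      (Matrix.of fun i j => cov[fun ω => ξ ω i, fun ω => ξ ω j; P])) =
    covarianceBilin (P.map ξ) := by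
  have hX : ∀ i, MemLp (fun ω => ξ ω i) 2 P := fun i =>
    (EuclideanSpace.proj (𝕜 := ℝ) i).comp_memLp' hξ
  ext x y
  rw [covarianceBilin_multivariateGaussian (posSemidef_covariance hX)]
  have := covarianceBilin_apply_pi hX x y
  change covarianceBilin (P.map ξ) x y = _ at this
  rw [this]
  simp only [dotProduct, Matrix.mulVec, Finset.mul_sum, Matrix.of_apply]
  refine Finset.sum_congr rfl fun i _ => Finset.sum_congr rfl fun j _ => by ring

/-- The asymptotic covariance matrix of the sample mean is the covariance matrix of the sampled
vector. -/
lemma isAsymptoticCov_mean {ξ : ℕ → Ω → EuclideanSpace ℝ ι} (hindep : iIndepFun ξ P)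
    (hident : ∀ i, IdentDistrib (ξ i) (ξ 0) P P) (hL2 : MemLp (ξ 0) 2 P) :
    IsAsymptoticCov P (fun (n : ℕ) ω => (n : ℝ)⁻¹ • ∑ k ∈ Finset.range n, ξ k ω)
      (∫ ω, ξ 0 ω ∂P) (Matrix.of fun i j => cov[fun ω => ξ 0 ω i, fun ω => ξ 0 ω j; P]) :=
  ⟨posSemidef_covariance fun i => (EuclideanSpace.proj (𝕜 := ℝ) i).comp_memLp' hL2,
    tendstoInDistribution_sqrt_smul_sampleMean_sub hindep hident hL2 _ (by simp)
      (covarianceBilin_multivariateGaussian_covariance _ hL2)⟩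

/-- Limits in distribution are unique, and semidefiniteness lets the matrix be read off the Gaussian
as the covariances of its coordinates. -/
lemma IsAsymptoticCov.unique {T : ℕ → Ω → EuclideanSpace ℝ ι} {θ : EuclideanSpace ℝ ι}
    {A B : Matrix ι ι ℝ} (hA : IsAsymptoticCov P T θ A) (hB : IsAsymptoticCov P T θ B) :
    A = B := by
  have h := tendstoInDistribution_unique _ hA.2 hB.2
  simp only [Measure.map_id] at h
  ext i j
  rw [← covariance_eval_multivariateGaussian (μ := 0) hA.1, h,
    covariance_eval_multivariateGaussian hB.1]

lemma IsAsymptoticCov.iff_eq {T : ℕ → Ω → EuclideanSpace ℝ ι} {θ : EuclideanSpace ℝ ι}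
    {W : Matrix ι ι ℝ} (hW : IsAsymptoticCov P T θ W) (A : Matrix ι ι ℝ) :
    IsAsymptoticCov P T θ A ↔ A = W :=
  ⟨fun hA => hA.unique hW, fun h => h ▸ hW⟩

/-- A linear image of a Gaussian is Gaussian, hence determined by its mean and covariance form.
Writing the matrix through covariances avoids choosing a matrix for `L`. -/
lemma map_multivariateGaussian_zero {A : Matrix ι ι ℝ}
    (L : EuclideanSpace ℝ ι →L[ℝ] EuclideanSpace ℝ κ) :
    (multivariateGaussian 0 A).map L = multivariateGaussian 0 (Matrix.of fun a b =>
      cov[fun x => L x a, fun x => L x b; multivariateGaussian 0 A]) := by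
  have hL : MemLp L 2 (multivariateGaussian 0 A) := L.comp_memLp' IsGaussian.memLp_two_id
  refine IsGaussian.ext ?_ (covarianceBilin_multivariateGaussian_covariance 0 hL).symm
  simp only [id]
  rw [L.integral_id_map IsGaussian.integrable_id]
  simp

/-- The delta method. -/
theorem IsAsymptoticCov.comp {T : ℕ → Ω → EuclideanSpace ℝ ι} {θ : EuclideanSpace ℝ ι}
    {A : Matrix ι ι ℝ} (hT : IsAsymptoticCov P T θ A) (hTm : ∀ n, AEMeasurable (T n) P)
    (hlim : ∀ᵐ ω ∂P, Tendsto (fun n => T n ω) atTop (𝓝 θ))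
    {f : EuclideanSpace ℝ ι → EuclideanSpace ℝ κ} (hfm : Measurable f)
    {L : EuclideanSpace ℝ ι →L[ℝ] EuclideanSpace ℝ κ} (hf : HasFDerivAt f L θ) :
    IsAsymptoticCov P (fun n ω => f (T n ω)) (f θ) (Matrix.of fun a b =>
      cov[fun x => L x a, fun x => L x b; multivariateGaussian 0 A]) := by
  have hL : MemLp L 2 (multivariateGaussian 0 A) := L.comp_memLp' IsGaussian.memLp_two_id
  refine ⟨posSemidef_covariance fun i => (EuclideanSpace.proj (𝕜 := ℝ) i).comp_memLp' hL, ?_⟩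
  -- The normalized Taylor remainder. As `0⁻¹ = 0`, it vanishes at `θ` itself, so it tends to 0
  -- along the full neighbourhood filter.
  set h : EuclideanSpace ℝ ι → EuclideanSpace ℝ κ :=
    fun x => ‖x - θ‖⁻¹ • (f x - f θ - L (x - θ)) with hdef
  have hm : Measurable h := by fun_prop
  have h0 : Tendsto h (𝓝 θ) (𝓝 0) := by
    rw [tendsto_zero_iff_norm_tendsto_zero]
    refine (hasFDerivAt_iff_tendsto.1 hf).congr fun x => ?_
    simp [hdef, norm_smul]
  have hprob : TendstoInMeasure P (fun n ω => h (T n ω)) atTop (fun _ => 0) :=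
    tendstoInMeasure_of_tendsto_ae
      (fun n => (hm.comp_aemeasurable (hTm n)).aestronglyMeasurable)
      (hlim.mono fun ω hω => h0.comp hω)
  -- Slutsky: the scaled error converges in law and the remainder tends to 0 in measure, so their
  -- product drops out of the limit.
  have hs := hT.2.continuous_comp_prodMk_of_tendstoInMeasure_const
    (g := fun q : EuclideanSpace ℝ ι × EuclideanSpace ℝ κ => L q.1 + ‖q.1‖ • q.2)
    (by fun_prop) hprob (fun n => hm.comp_aemeasurable (hTm n))
  have e : (fun (n : ℕ) ω => √(n : ℝ) • (f (T n ω) - f θ)) = fun (n : ℕ) ω =>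
      L (√(n : ℝ) • (T n ω - θ)) + ‖√(n : ℝ) • (T n ω - θ)‖ • h (T n ω) := by
    ext1 n
    ext1 ω
    simp only [hdef, norm_smul, Real.norm_eq_abs, abs_of_nonneg (Real.sqrt_nonneg (n : ℝ)),
      map_smul]
    by_cases hx : T n ω = θ
    · simp [hx]
    · have : ‖T n ω - θ‖ ≠ 0 := by simpa [sub_eq_zero] using hx
      rw [smul_smul, mul_assoc, mul_inv_cancel₀ this, mul_one, ← smul_add]
      congr 1
      abel
  rw [e]
  refine ⟨hs.forall_aemeasurable, aemeasurable_id, ?_⟩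
  have ht := hs.tendsto
  convert ht using 2
  congr 1
  refine Subtype.ext ?_
  simp only [id, smul_zero, add_zero]
  refine Measure.map_id.trans ?_
  exact (map_multivariateGaussian_zero L).symm

end AsymptoticCov

/-! ### Derivatives of matrix inverses; algebra of partial correlations. -/

section Matrix

/-- The derivative of the entries of the inverse of a matrix-valued function. -/
lemma hasFDerivAt_matrix_inv_apply {n E : Type*} [Fintype n] [DecidableEq n]
    [NormedAddCommGroup E] [NormedSpace ℝ E] {N : E → Matrix n n ℝ} {N' : n → n → (E →L[ℝ] ℝ)}
    {x : E} (h : ∀ i j, HasFDerivAt (fun y => N y i j) (N' i j) x) (hu : IsUnit (N x).det)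
    (i j : n) :
    HasFDerivAt (fun y => (N y)⁻¹ i j)
      (-∑ k, ∑ l, ((N x)⁻¹ i k * (N x)⁻¹ l j) • N' k l) x := by
  -- Any submultiplicative norm serves here: it is needed only to differentiate inversion in a
  -- normed ring, and the result is entrywise.
  let := Matrix.linftyOpNormedRing (n := n) (α := ℝ)
  let := Matrix.linftyOpNormedAlgebra (n := n) (α := ℝ) (R := ℝ)
  let ofL : (n → n → ℝ) →L[ℝ] Matrix n n ℝ :=
    LinearMap.toContinuousLinearMap (Matrix.ofLinearEquiv ℝ).toLinearMap
  let entry : Matrix n n ℝ →L[ℝ] ℝ :=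
    LinearMap.toContinuousLinearMap (Matrix.entryLinearMap ℝ ℝ i j)
  have h1 : HasFDerivAt (fun y => (fun i j => N y i j : n → n → ℝ))
      (ContinuousLinearMap.pi fun i => ContinuousLinearMap.pi fun j => N' i j) x :=
    hasFDerivAt_pi.2 fun i => hasFDerivAt_pi.2 fun j => h i j
  have h2 : HasFDerivAt N (ofL ∘L (ContinuousLinearMap.pi fun i => ContinuousLinearMap.pi fun j =>
      N' i j)) x := ofL.hasFDerivAt.comp x h1
  obtain ⟨u, hu'⟩ := (Matrix.isUnit_iff_isUnit_det _).2 hu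
  have h3 := hasFDerivAt_ringInverse (𝕜 := ℝ) u
  rw [hu'] at h3
  have h4 := entry.hasFDerivAt.comp x (h3.comp x h2)
  have e : (⇑entry ∘ Ring.inverse ∘ N) = fun y => (N y)⁻¹ i j := by
    ext y
    simp [entry, Matrix.nonsing_inv_eq_ringInverse]
  rw [e] at h4
  refine h4.congr_fderiv ?_
  ext v
  have hinv : ((u⁻¹ : (Matrix n n ℝ)ˣ) : Matrix n n ℝ) = (N x)⁻¹ := by
    rw [← hu', Matrix.coe_units_inv]
  simp only [hinv, neg_apply,
    sum_apply, smul_apply, smul_eq_mul]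
  change (-((N x)⁻¹ * (Matrix.of fun k l => N' k l v) * (N x)⁻¹)) i j = _
  rw [Matrix.neg_apply]
  congr 1
  simp only [Matrix.mul_apply, Finset.sum_mul, Matrix.of_apply]
  rw [Finset.sum_comm]
  exact Finset.sum_congr rfl fun k _ => Finset.sum_congr rfl fun l _ => by ring

lemma hasFDerivAt_neg_div_sqrt {E : Type*} [NormedAddCommGroup E] [NormedSpace ℝ E]
    {u v w : E → ℝ} {u' v' w' : E →L[ℝ] ℝ} {x : E} (hu : HasFDerivAt u u' x)
    (hv : HasFDerivAt v v' x) (hw : HasFDerivAt w w' x) (hv0 : 0 < v x) (hw0 : 0 < w x) :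
    HasFDerivAt (fun y => -u y / √(v y * w y))
      ((-(1 / √(v x * w x))) • u' +
        (u x / (2 * √(v x * w x))) • ((1 / v x) • v' + (1 / w x) • w')) x := by
  have h0 : 0 < v x * w x := mul_pos hv0 hw0
  have hs := Real.sqrt_pos.2 h0
  have h1 := (hasDerivAt_inv hs.ne').comp_hasFDerivAt x ((hv.mul hw).sqrt h0.ne')
  have h := hu.neg.mul h1
  simp only [div_eq_mul_inv]
  refine h.congr_fderiv ?_
  ext z
  have hq : √(v x * w x) ^ 2 = v x * w x := Real.sq_sqrt h0.le
  simp
  field_simp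
  rw [hq]
  ring

variable {V : Type*} [DecidableEq V]

/-- In the singular case both sides are 0 by the convention for inverses, so only `c ≠ 0` is needed.
-/
lemma marginalPrecision_smul (A : Matrix V V ℝ) (T : Finset V) {c : ℝ} (hc : c ≠ 0) :
    marginalPrecision (c • A) T = c⁻¹ • marginalPrecision A T := by
  unfold marginalPrecision
  rw [Matrix.submatrix_smul]
  simp only [Pi.smul_apply]
  by_cases h : IsUnit (A.submatrix (fun t : T => (t : V)) (fun t : T => (t : V))).det
  · exact Matrix.inv_smul' _ (Units.mk0 c hc) h
  · rw [Matrix.nonsing_inv_apply_not_isUnit _ h, Matrix.nonsing_inv_apply_not_isUnit, smul_zero]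
    rw [Matrix.det_smul]
    simpa [hc] using h

/-- Partial correlations are invariant under scaling of the covariance matrix. -/
lemma partialCorr_smul (A : Matrix V V ℝ) (C : Finset V) (i j : V) {c : ℝ} (hc : 0 < c) :
    partialCorr (c • A) C i j = partialCorr A C i j := by
  simp only [partialCorr, marginalPrecision_smul A _ hc.ne', Matrix.smul_apply, smul_eq_mul]
  have hc' : 0 < c⁻¹ := inv_pos.2 hc
  rw [mul_mul_mul_comm, Real.sqrt_mul (by positivity), Real.sqrt_mul_self hc'.le, ← mul_neg,
    mul_div_mul_left _ _ hc'.ne']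

lemma marginalPrecision_posDef {A : Matrix V V ℝ} (hA : A.PosDef) (T : Finset V) :
    (marginalPrecision A T).PosDef :=
  (hA.submatrix Subtype.val_injective).inv

/-- This is positivity of the 2 × 2 principal minor on `i`, `j`. -/
lemma sq_lt_mul_of_posDef {n : Type*} {κ : Matrix n n ℝ} (hκ : κ.PosDef) {i j : n} (hij : i ≠ j) :
    κ i j ^ 2 < κ i i * κ j j := by
  have hinj : Function.Injective ![i, j] := by
    intro a b
    fin_cases a <;> fin_cases b <;> simp [hij, hij.symm]
  have h := (hκ.submatrix hinj).det_pos
  have hs : κ j i = κ i j := by simpa using hκ.1.apply i j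
  rw [Matrix.det_fin_two] at h
  simp [hs] at h
  nlinarith

lemma partialCorr_mem_Ioo {A : Matrix V V ℝ} (hA : A.PosDef) (C : Finset V) {i j : V}
    (hij : i ≠ j) : partialCorr A C i j ∈ Set.Ioo (-1 : ℝ) 1 := by
  have hκ := marginalPrecision_posDef hA (insert i (insert j C))
  have hlt := sq_lt_mul_of_posDef hκ (i := ⟨i, by simp⟩) (j := ⟨j, by simp⟩) (by simpa using hij)
  rw [Set.mem_Ioo, ← abs_lt]
  simp only [partialCorr]
  have h0 := (sq_nonneg _).trans_lt hlt
  rw [abs_div, abs_neg, abs_of_nonneg (Real.sqrt_nonneg _), div_lt_one (Real.sqrt_pos.2 h0)]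
  exact Real.lt_sqrt_of_sq_lt (by rwa [sq_abs])

end Matrix

/-! ### Sample covariance as a function of empirical moments. -/

section Moments

variable {V : Type*}

/-- The vector of all first and second order monomials in the entries of `x`. -/
noncomputable def momentVec (x : EuclideanSpace ℝ V) : EuclideanSpace ℝ ((V × V) ⊕ V) :=
  WithLp.toLp 2 (Sum.elim (fun q => x q.1 * x q.2) fun i => x i)

/-- The covariance matrix belonging to a vector of first and second moments. -/
noncomputable def covOfMoments (t : EuclideanSpace ℝ ((V × V) ⊕ V)) : Matrix V V ℝ :=
  Matrix.of fun i j => t (Sum.inl (i, j)) - t (Sum.inr i) * t (Sum.inr j)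

/-- Covariance is translation invariant, so the center `m` is free; it will be the true mean, which
makes the limiting first moments vanish. -/
lemma sampleCov_eq_smul_covOfMoments [Finite V] (n : ℕ) (y : ℕ → EuclideanSpace ℝ V)
    (m : EuclideanSpace ℝ V) :
    sampleCov n y = ((n : ℝ) / (n - 1)) •
      covOfMoments ((n : ℝ)⁻¹ • ∑ k ∈ Finset.range n, momentVec (y k - m)) := by
  have := Fintype.ofFinite V
  ext i j
  rcases Nat.eq_zero_or_pos n with rfl | hn
  · simp [sampleCov]
  have hn' : (n : ℝ) ≠ 0 := by positivity
  have hm : ∀ l : V, sampleMean n y l = (n : ℝ)⁻¹ * ∑ k ∈ Finset.range n, (y k l - m l) + m l := by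
    intro l
    simp only [sampleMean, Finset.sum_sub_distrib, Finset.sum_const, Finset.card_range,
      nsmul_eq_mul]
    field_simp
    ring
  have hsum : ∑ k ∈ Finset.range n, (y k i - sampleMean n y i) * (y k j - sampleMean n y j)
      = ∑ k ∈ Finset.range n, (y k i - m i) * (y k j - m j) - (n : ℝ)⁻¹ *
        ((∑ k ∈ Finset.range n, (y k i - m i)) * ∑ k ∈ Finset.range n, (y k j - m j)) := by
    rw [hm, hm]
    set a := ∑ k ∈ Finset.range n, (y k i - m i)
    set b := ∑ k ∈ Finset.range n, (y k j - m j)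
    have : ∀ k, (y k i - ((n : ℝ)⁻¹ * a + m i)) * (y k j - ((n : ℝ)⁻¹ * b + m j))
        = (y k i - m i) * (y k j - m j) - (y k i - m i) * ((n : ℝ)⁻¹ * b)
          - ((n : ℝ)⁻¹ * a) * (y k j - m j) + ((n : ℝ)⁻¹ * a) * ((n : ℝ)⁻¹ * b) := fun k => by ring
    simp only [this, Finset.sum_add_distrib, Finset.sum_sub_distrib, ← Finset.sum_mul,
      ← Finset.mul_sum, Finset.sum_const, Finset.card_range, nsmul_eq_mul]
    have ha : ∑ k ∈ Finset.range n, y k i - ∑ k ∈ Finset.range n, m i = a := by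
      simp [a]
    have hb : ∑ k ∈ Finset.range n, y k j - ∑ k ∈ Finset.range n, m j = b := by
      simp [b]
    simp only [Finset.sum_const, Finset.card_range, nsmul_eq_mul] at ha hb
    rw [ha, hb]
    field_simp
    ring
  simp only [sampleCov, Matrix.of_apply, hsum, covOfMoments, Matrix.smul_apply, smul_eq_mul,
    PiLp.smul_apply, momentVec, WithLp.ofLp_sum, Finset.sum_apply, Sum.elim_inl, Sum.elim_inr,
    PiLp.sub_apply]
  field_simp

lemma continuous_covOfMoments : Continuous (covOfMoments (V := V)) := by
  refine continuous_matrix fun i j => ?_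
  simp only [covOfMoments, Matrix.of_apply]
  fun_prop

lemma measurable_momentVec [Fintype V] : Measurable (momentVec (V := V)) := by
  refine Continuous.measurable ?_
  refine (PiLp.continuous_toLp 2 _).comp (continuous_pi fun s => ?_)
  rcases s with s | s <;> simp only [Sum.elim_inl, Sum.elim_inr] <;> fun_prop

variable [Fintype V] [DecidableEq V]

lemma partialCorr_sampleCov (n : ℕ) (y : ℕ → EuclideanSpace ℝ V) (m : EuclideanSpace ℝ V)
    (C : Finset V) (i j : V) :
    partialCorr (sampleCov n y) C i j =
      partialCorr (covOfMoments ((n : ℝ)⁻¹ • ∑ k ∈ Finset.range n, momentVec (y k - m))) C i j := by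
  rw [sampleCov_eq_smul_covOfMoments n y m]
  -- For `n ≤ 1` the factor `n / (n - 1)` is not positive, but the moment covariance is then the
  -- zero matrix.
  rcases le_or_gt n 1 with hn | hn
  · have h0 : covOfMoments ((n : ℝ)⁻¹ • ∑ k ∈ Finset.range n, momentVec (y k - m)) = 0 := by
      ext i j
      interval_cases n <;> simp [covOfMoments, momentVec]
    rw [h0, smul_zero]
  · have hn' : (1 : ℝ) < n := by exact_mod_cast hn
    exact partialCorr_smul _ _ _ _ (div_pos (by linarith) (by linarith))

/-- The adjugate formula gives measurability everywhere, including at singular matrices, where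
continuity may fail. -/
lemma measurable_marginalPrecision_covOfMoments (T : Finset V) (i j : T) :
    Measurable fun t => marginalPrecision (covOfMoments t) T i j := by
  simp only [marginalPrecision, Matrix.inv_def, Matrix.smul_apply, smul_eq_mul, Ring.inverse_eq_inv]
  have hc : Continuous fun t : EuclideanSpace ℝ ((V × V) ⊕ V) =>
      (covOfMoments t).submatrix (fun t : T => (t : V)) (fun t : T => (t : V)) :=
    continuous_covOfMoments.matrix_submatrix _ _
  exact hc.matrix_det.measurable.inv.mul (hc.matrix_adjugate.matrix_elem i j).measurable

lemma measurable_partialCorr_covOfMoments (C : Finset V) (i j : V) :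
    Measurable fun t => partialCorr (covOfMoments t) C i j := by
  have h := fun k l => measurable_marginalPrecision_covOfMoments (insert i (insert j C)) k l
  exact (h _ _).neg.div ((h _ _).mul (h _ _)).sqrt

end Moments

/-- The `s`th coordinate as a continuous linear map. -/
noncomputable def coord {ι : Type*} [Fintype ι] (s : ι) : EuclideanSpace ℝ ι →L[ℝ] ℝ :=
  EuclideanSpace.proj s

@[simp]
lemma coord_apply {ι : Type*} [Fintype ι] (s : ι) (x : EuclideanSpace ℝ ι) : coord s x = x s :=
  rfl

lemma holderTriple_four_four_two : ENNReal.HolderTriple 4 4 2 := ⟨by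
  rw [← ENNReal.toReal_eq_toReal_iff' (by simp) (by simp)]
  rw [ENNReal.toReal_add (by simp) (by simp)]
  simp
  norm_num⟩

/-! ### Variance of a quadratic form in two Gaussians. -/

section GaussianQuadratic

variable {Ω : Type*} [MeasurableSpace Ω] {P : Measure Ω}

lemma variance_sq_of_hasGaussianLaw {X : Ω → ℝ} (hX : HasGaussianLaw X P) (h0 : ∫ ω, X ω ∂P = 0) :
    Var[fun ω => X ω ^ 2; P] = 2 * Var[X; P] ^ 2 := by
  have h : HasLaw X (gaussianReal 0 (Var[X; P]).toNNReal) P :=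
    ⟨hX.aemeasurable, by rw [hX.map_eq_gaussianReal, h0]⟩
  rw [variance_sq_of_hasLaw_gaussianReal h, Real.coe_toNNReal _ (variance_nonneg _ _)]

/-- The variance of a quadratic form in two jointly Gaussian standardized variables with
covariance `c`. -/
lemma variance_mul_sub_of_hasGaussianLaw [IsProbabilityMeasure P] {U V : Ω → ℝ} {c : ℝ}
    (h : HasGaussianLaw (fun ω => (U ω, V ω)) P) (hU0 : ∫ ω, U ω ∂P = 0)
    (hV0 : ∫ ω, V ω ∂P = 0) (hU : Var[U; P] = 1) (hV : Var[V; P] = 1) (hc : cov[U, V; P] = c) :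
    Var[fun ω => U ω * V ω - c / 2 * (U ω ^ 2 + V ω ^ 2); P] = (1 - c ^ 2) ^ 2 := by
  have mU : MemLp U 2 P := h.fst.memLp_two
  have mV : MemLp V 2 P := h.snd.memLp_two
  have iU : Integrable U P := mU.integrable (by simp)
  have iV : Integrable V P := mV.integrable (by simp)
  have hA : HasGaussianLaw (U + V) P := h.add
  have hB : HasGaussianLaw (U - V) P := h.sub
  have hAB : HasGaussianLaw (fun ω => ((U + V) ω, (U - V) ω)) P :=
    h.map ((ContinuousLinearMap.fst ℝ ℝ ℝ + ContinuousLinearMap.snd ℝ ℝ ℝ).prod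
      (ContinuousLinearMap.fst ℝ ℝ ℝ - ContinuousLinearMap.snd ℝ ℝ ℝ))
  have hcov : cov[U + V, U - V; P] = 0 := by
    rw [covariance_add_left mU mV (mU.sub mV), covariance_sub_right mU mU mV,
      covariance_sub_right mV mU mV, covariance_self mU.aemeasurable,
      covariance_self mV.aemeasurable, covariance_comm V U, hU, hV]
    ring
  have hind : IndepFun (U + V) (U - V) P := hAB.indepFun_of_covariance_eq_zero hcov
  have vA : Var[U + V; P] = 2 * (1 + c) := by
    rw [variance_add mU mV, hU, hV, hc]; ring
  have vB : Var[U - V; P] = 2 * (1 - c) := by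
    rw [variance_sub mU mV, hU, hV, hc]; ring
  have hA2 := variance_sq_of_hasGaussianLaw hA (by
    simp only [Pi.add_apply]; rw [integral_add iU iV, hU0, hV0, add_zero])
  have hB2 := variance_sq_of_hasGaussianLaw hB (by
    simp only [Pi.sub_apply]; rw [integral_sub iU iV, hU0, hV0, sub_zero])
  -- The form is diagonal in `U + V` and `U - V`, which are independent because `U` and `V` have
  -- equal variances. Each square contributes `(1 - c²)² / 2`.
  have e : (fun ω => U ω * V ω - c / 2 * (U ω ^ 2 + V ω ^ 2)) =
      (fun ω => (1 - c) / 4 * (U + V) ω ^ 2) + fun ω => -(1 + c) / 4 * (U - V) ω ^ 2 := by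
    ext ω
    simp only [Pi.add_apply, Pi.sub_apply]
    ring
  have m2 : ∀ {X : Ω → ℝ} (a : ℝ), HasGaussianLaw X P → MemLp (fun ω => a * X ω ^ 2) 2 P := by
    intro X a hX
    have h4 : MemLp X 4 P := hX.memLp (by simp)
    have h2 : MemLp (X * X) 2 P := h4.mul h4 (hpqr := holderTriple_four_four_two)
    have := h2.const_mul a
    refine this.ae_eq (ae_of_all _ fun ω => ?_)
    simp [sq]
  have hind2 : IndepFun (fun ω => (1 - c) / 4 * (U + V) ω ^ 2)
      (fun ω => -(1 + c) / 4 * (U - V) ω ^ 2) P :=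
    hind.comp (φ := fun x => (1 - c) / 4 * x ^ 2) (ψ := fun x => -(1 + c) / 4 * x ^ 2)
      (by fun_prop) (by fun_prop)
  rw [e, hind2.variance_add (m2 _ hA) (m2 _ hB), variance_const_mul, variance_const_mul, hA2, hB2,
    vA, vB]
  ring

end GaussianQuadratic

/-! ### Linearization of a partial correlation at the true moments. -/

section Derivative

variable {V : Type*}

/-- The first and second moments of a centered random vector with covariance matrix `S`. -/
noncomputable def centeredMoments (S : Matrix V V ℝ) : EuclideanSpace ℝ ((V × V) ⊕ V) :=
  WithLp.toLp 2 (Sum.elim (fun q => S q.1 q.2) fun _ => 0)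

lemma covOfMoments_centeredMoments (S : Matrix V V ℝ) :
    covOfMoments (centeredMoments S) = S := by
  ext i j
  simp [covOfMoments, centeredMoments]

/-- The first moments vanish at the base point, so the product rule for the mean term contributes
nothing. -/
lemma hasFDerivAt_covOfMoments [Fintype V] (S : Matrix V V ℝ) (i j : V) :
    HasFDerivAt (fun t => covOfMoments t i j)
      (coord (Sum.inl (i, j)))
      (centeredMoments S) := by
  have h := fun s => (coord s).hasFDerivAt
    (x := centeredMoments S)
  refine ((h (Sum.inl (i, j))).sub ((h (Sum.inr i)).mul (h (Sum.inr j)))).congr_fderiv ?_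
  ext t
  simp [centeredMoments]

variable [Fintype V] [DecidableEq V]

/-- The standardized linear combination of the variables in `T` whose coefficients are the `i`th
row of the precision matrix. -/
noncomputable def standardizedResidual (S : Matrix V V ℝ) (T : Finset V) (i : T)
    (x : EuclideanSpace ℝ V) : ℝ :=
  (∑ k, marginalPrecision S T i k * x k) / √(marginalPrecision S T i i)

/-- On the monomials of `x` the covariance increment is `x xᵀ`, so `κ i j` changes by `-(κ x)_i (κ
x)_j`. The numerator yields the product of residuals, and the logarithmic derivative of the
denominator yields their squares. -/
lemma exists_hasFDerivAt_neg_div_sqrt_marginalPrecision {S : Matrix V V ℝ} (hS : S.PosDef)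
    (T : Finset V) (i j : T) :
    ∃ L : EuclideanSpace ℝ ((V × V) ⊕ V) →L[ℝ] ℝ,
      HasFDerivAt (fun t => -marginalPrecision (covOfMoments t) T i j /
        √(marginalPrecision (covOfMoments t) T i i * marginalPrecision (covOfMoments t) T j j)) L
        (centeredMoments S) ∧
      ∀ x, L (momentVec x) =
        standardizedResidual S T i x * standardizedResidual S T j x -
        (-(-marginalPrecision S T i j / √(marginalPrecision S T i i * marginalPrecision S T j j))) /
          2 * (standardizedResidual S T i x ^ 2 + standardizedResidual S T j x ^ 2) := by
  have hκ := marginalPrecision_posDef hS T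
  have hsym : ∀ a b, marginalPrecision S T a b = marginalPrecision S T b a := fun a b => by
    simpa using hκ.1.apply b a
  have hN : IsUnit ((covOfMoments (centeredMoments S)).submatrix
      (fun t : T => (t : V)) (fun t : T => (t : V))).det := by
    rw [covOfMoments_centeredMoments]
    exact (hS.submatrix Subtype.val_injective).det_pos.ne'.isUnit
  have hinv := fun a b => hasFDerivAt_matrix_inv_apply
    (N := fun t => (covOfMoments t).submatrix (fun t : T => (t : V)) (fun t : T => (t : V)))
    (fun a b => hasFDerivAt_covOfMoments S a b) hN a b
  simp only [covOfMoments_centeredMoments] at hinv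
  have hval : ∀ a b, (S.submatrix (fun t : T => (t : V)) (fun t : T => (t : V)))⁻¹ a b =
      marginalPrecision S T a b := fun _ _ => rfl
  simp only [hval] at hinv
  have hpi := hκ.diag_pos (i := i)
  have hpj := hκ.diag_pos (i := j)
  have hD := hasFDerivAt_neg_div_sqrt (hinv i j) (hinv i i) (hinv j j)
    (by simpa only [covOfMoments_centeredMoments, hval] using hpi)
    (by simpa only [covOfMoments_centeredMoments, hval] using hpj)
  refine ⟨_, hD, fun x => ?_⟩
  have key : ∀ a b : T, (∑ k, ∑ l, (marginalPrecision S T a k * marginalPrecision S T l b) •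
      (coord
        (Sum.inl ((k : V), (l : V))))) (momentVec x) =
      (∑ k, marginalPrecision S T a k * x k) * ∑ k, marginalPrecision S T b k * x k := by
    intro a b
    rw [Finset.sum_mul_sum]
    simp only [sum_apply, smul_apply, smul_eq_mul]
    refine Finset.sum_congr rfl fun k _ => Finset.sum_congr rfl fun l _ => ?_
    simp only [coord_apply, momentVec, Sum.elim_inl, hsym l b]
    ring
  simp only [covOfMoments_centeredMoments, hval, add_apply, smul_apply, neg_apply, key,
    smul_eq_mul]
  simp only [standardizedResidual]
  set p := ∑ k, marginalPrecision S T i k * x k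
  set q := ∑ k, marginalPrecision S T j k * x k
  rw [Real.sqrt_mul hpi.le]
  have s1 := Real.sq_sqrt hpi.le
  have s2 := Real.sq_sqrt hpj.le
  have p1 := Real.sqrt_pos.2 hpi
  have p2 := Real.sqrt_pos.2 hpj
  simp only [div_pow, s1, s2]
  field_simp
  ring

lemma exists_hasFDerivAt_partialCorr {S : Matrix V V ℝ} (hS : S.PosDef) (C : Finset V) (i j : V) :
    ∃ L : EuclideanSpace ℝ ((V × V) ⊕ V) →L[ℝ] ℝ,
      HasFDerivAt (fun t => partialCorr (covOfMoments t) C i j) L (centeredMoments S) ∧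
      ∀ x, L (momentVec x) =
        standardizedResidual S (insert i (insert j C)) ⟨i, by simp⟩ x *
          standardizedResidual S (insert i (insert j C)) ⟨j, by simp⟩ x -
        (-partialCorr S C i j) / 2 *
          (standardizedResidual S (insert i (insert j C)) ⟨i, by simp⟩ x ^ 2 +
            standardizedResidual S (insert i (insert j C)) ⟨j, by simp⟩ x ^ 2) :=
  exists_hasFDerivAt_neg_div_sqrt_marginalPrecision hS (insert i (insert j C)) ⟨i, by simp⟩
    ⟨j, by simp⟩

end Derivative

/-! ### Gaussian law of the residuals and moments. -/

section ResidualLaw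

variable {V : Type*} [Fintype V] [DecidableEq V] {Ω : Type*} [MeasurableSpace Ω] {P : Measure Ω}
  {X : Ω → EuclideanSpace ℝ V} {S : Matrix V V ℝ}

lemma memLp_of_hasLaw (hX : HasLaw X (multivariateGaussian 0 S) P) (i : V) {q : ENNReal}
    (hq : q ≠ ⊤) : MemLp (fun ω => X ω i) q P :=
  (hX.hasGaussianLaw.map (coord i)).memLp hq

lemma integral_of_hasLaw (hX : HasLaw X (multivariateGaussian 0 S) P) (i : V) :
    ∫ ω, X ω i ∂P = 0 := by
  have h := (coord i).integral_comp_comm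
    (hX.hasGaussianLaw.integrable)
  rw [hX.integral_eq] at h
  simpa using h

lemma covariance_of_hasLaw (hS : S.PosSemidef) (hX : HasLaw X (multivariateGaussian 0 S) P)
    (i j : V) : cov[fun ω => X ω i, fun ω => X ω j; P] = S i j := by
  rw [← covariance_eval_multivariateGaussian (μ := 0) hS i j]
  exact hX.covariance_comp (f := fun x => x i) (g := fun x => x j) (by fun_prop) (by fun_prop)

lemma integral_standardizedResidual [IsProbabilityMeasure P]
    (hX : HasLaw X (multivariateGaussian 0 S) P) (T : Finset V)
    (i : T) : ∫ ω, standardizedResidual S T i (X ω) ∂P = 0 := by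
  simp only [standardizedResidual]
  rw [integral_div, integral_finsetSum]
  · simp [integral_const_mul, integral_of_hasLaw hX]
  · exact fun k _ => ((memLp_of_hasLaw hX k (q := 1) (by simp)).integrable le_rfl).const_mul _

/-- The covariance matrix of `κ X` is `κ Σ_T κ = κ`, because `κ` is symmetric and inverse to `Σ_T`.
-/
lemma covariance_standardizedResidual [IsProbabilityMeasure P] (hS : S.PosDef)
    (hX : HasLaw X (multivariateGaussian 0 S) P) (T : Finset V) (i j : T) :
    cov[fun ω => standardizedResidual S T i (X ω), fun ω => standardizedResidual S T j (X ω); P] =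
      marginalPrecision S T i j /
        (√(marginalPrecision S T i i) * √(marginalPrecision S T j j)) := by
  have hκ := marginalPrecision_posDef hS T
  have hN : IsUnit (S.submatrix (fun t : T => (t : V)) (fun t : T => (t : V))).det :=
    (hS.submatrix Subtype.val_injective).det_pos.ne'.isUnit
  have hm : ∀ (a k : T), MemLp (fun ω => marginalPrecision S T a k * X ω k) 2 P := fun a k =>
    (memLp_of_hasLaw hX k (by simp)).const_mul _
  simp only [standardizedResidual, div_eq_mul_inv]
  rw [covariance_mul_const_left, covariance_mul_const_right,
    covariance_fun_sum_fun_sum (fun k => hm i k) (fun k => hm j k)]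
  simp only [covariance_const_mul_left, covariance_const_mul_right,
    covariance_of_hasLaw hS.posSemidef hX]
  have h : ∑ k : T, ∑ l : T, marginalPrecision S T j l * (marginalPrecision S T i k * S k l) =
      marginalPrecision S T i j := by
    have h1 : marginalPrecision S T *
        S.submatrix (fun t : T => (t : V)) (fun t : T => (t : V)) = 1 :=
      Matrix.nonsing_inv_mul _ hN
    have h2 := congrFun (congrFun (Matrix.one_mul (marginalPrecision S T)) i) j
    rw [← h1] at h2
    rw [← h2]
    simp only [Matrix.mul_apply, Finset.sum_mul, Matrix.submatrix_apply]
    rw [Finset.sum_comm]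
    refine Finset.sum_congr rfl fun k _ => Finset.sum_congr rfl fun l _ => ?_
    have : marginalPrecision S T j k = marginalPrecision S T k j := by
      simpa using hκ.1.apply k j
    rw [this]
    ring
  rw [h, mul_inv]
  ring

lemma variance_standardizedResidual [IsProbabilityMeasure P] (hS : S.PosDef)
    (hX : HasLaw X (multivariateGaussian 0 S) P) (T : Finset V) (i : T) :
    Var[fun ω => standardizedResidual S T i (X ω); P] = 1 := by
  have hp := (marginalPrecision_posDef hS T).diag_pos (i := i)
  have hX' := hX.aemeasurable
  rw [← covariance_self, covariance_standardizedResidual hS hX, Real.mul_self_sqrt hp.le,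
    div_self hp.ne']
  unfold standardizedResidual
  fun_prop

lemma hasGaussianLaw_standardizedResidual [IsProbabilityMeasure P]
    (hX : HasLaw X (multivariateGaussian 0 S) P)
    (T : Finset V) (i j : T) :
    HasGaussianLaw (fun ω => (standardizedResidual S T i (X ω), standardizedResidual S T j (X ω)))
      P := by
  let ℓ : T → EuclideanSpace ℝ V →L[ℝ] ℝ := fun a => (√(marginalPrecision S T a a))⁻¹ •
    ∑ k : T, marginalPrecision S T a k • coord (k : V)
  have hℓ : ∀ a x, ℓ a x = standardizedResidual S T a x := fun a x => by
    simp [ℓ, standardizedResidual, div_eq_inv_mul, sum_apply]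
  have := hX.hasGaussianLaw.map ((ℓ i).prod (ℓ j))
  refine this.congr (ae_of_all _ fun ω => ?_)
  simp [hℓ]

/-- The variance of the linearized partial correlation. -/
lemma variance_linearized_partialCorr [IsProbabilityMeasure P] (hS : S.PosDef)
    (hX : HasLaw X (multivariateGaussian 0 S) P) (C : Finset V) (i j : V)
    {L : EuclideanSpace ℝ ((V × V) ⊕ V) →L[ℝ] ℝ}
    (hL : ∀ x, L (momentVec x) =
        standardizedResidual S (insert i (insert j C)) ⟨i, by simp⟩ x *
          standardizedResidual S (insert i (insert j C)) ⟨j, by simp⟩ x -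
        (-partialCorr S C i j) / 2 *
          (standardizedResidual S (insert i (insert j C)) ⟨i, by simp⟩ x ^ 2 +
            standardizedResidual S (insert i (insert j C)) ⟨j, by simp⟩ x ^ 2)) :
    Var[fun ω => L (momentVec (X ω)); P] = (1 - partialCorr S C i j ^ 2) ^ 2 := by
  simp only [hL]
  rw [variance_mul_sub_of_hasGaussianLaw (hasGaussianLaw_standardizedResidual hX _ _ _)
    (integral_standardizedResidual hX _ _) (integral_standardizedResidual hX _ _)
    (variance_standardizedResidual hS hX _ _) (variance_standardizedResidual hS hX _ _), neg_sq]
  rw [covariance_standardizedResidual hS hX]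
  simp only [partialCorr]
  rw [Real.sqrt_mul (marginalPrecision_posDef hS _).diag_pos.le, neg_div, neg_neg]

lemma memLp_momentVec [IsProbabilityMeasure P]
    (hX : HasLaw X (multivariateGaussian 0 S) P) :
    MemLp (fun ω => momentVec (X ω)) 2 P := by
  have h4 := holderTriple_four_four_two
  refine MemLp.of_eval_piLp fun s => ?_
  rcases s with ⟨i, j⟩ | i
  · exact (memLp_of_hasLaw hX j (q := 4) (by simp)).mul
      (memLp_of_hasLaw hX i (q := 4) (by simp))
  · exact memLp_of_hasLaw hX i (by simp)

lemma integral_momentVec [IsProbabilityMeasure P] (hS : S.PosDef)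
    (hX : HasLaw X (multivariateGaussian 0 S) P) :
    ∫ ω, momentVec (X ω) ∂P = centeredMoments S := by
  ext s
  have h := (coord s).integral_comp_comm
    ((memLp_momentVec hX).integrable (by simp))
  refine h.symm.trans ?_
  rcases s with ⟨i, j⟩ | i
  · have hc := covariance_eq_sub (memLp_of_hasLaw hX i (q := 2) (by simp))
      (memLp_of_hasLaw hX j (by simp))
    rw [covariance_of_hasLaw hS.posSemidef hX, integral_of_hasLaw hX] at hc
    simpa [centeredMoments, momentVec] using hc.symm
  · simpa [centeredMoments, momentVec] using integral_of_hasLaw hX i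

end ResidualLaw

/-! ### Vector-valued derivatives and Fisher's transform. -/

section Assembly

lemma measurable_fisherZVec {κ : Type*} : Measurable (fisherZVec (ι := κ)) := by
  refine (WithLp.measurable_toLp 2 _).comp (measurable_pi_lambda _ fun a => ?_)
  simp only [fisherZ]
  fun_prop

variable {ι κ : Type*} [Fintype ι] [Fintype κ] [DecidableEq ι]

lemma hasFDerivAt_toLp {E : Type*} [NormedAddCommGroup E] [NormedSpace ℝ E] {f : κ → E → ℝ}
    {L : κ → E →L[ℝ] ℝ} {x : E} (h : ∀ a, HasFDerivAt (f a) (L a) x) :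
    HasFDerivAt (fun y => (WithLp.toLp 2 fun a => f a y : EuclideanSpace ℝ κ))
      ((EuclideanSpace.equiv κ ℝ).symm.toContinuousLinearMap ∘L ContinuousLinearMap.pi L) x :=
  (EuclideanSpace.equiv κ ℝ).symm.toContinuousLinearMap.hasFDerivAt.comp x (hasFDerivAt_pi.2 h)

/-- A linear functional has the same variance under the Gaussian limit as under the sampled law. -/
lemma variance_clm_multivariateGaussian_covariance {Ω : Type*} [MeasurableSpace Ω] {P : Measure Ω}
    [IsProbabilityMeasure P] {ξ : Ω → EuclideanSpace ℝ ι} (hξ : MemLp ξ 2 P)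
    (ℓ : EuclideanSpace ℝ ι →L[ℝ] ℝ) :
    Var[fun x => ℓ x; multivariateGaussian 0
      (Matrix.of fun i j => cov[fun ω => ξ ω i, fun ω => ξ ω j; P])] =
    Var[fun ω => ℓ (ξ ω); P] := by
  have hm := hξ.aestronglyMeasurable.aemeasurable
  have : IsProbabilityMeasure (P.map ξ) := Measure.isProbabilityMeasure_map hm
  -- The functional is represented by a vector (Riesz), so its variance is a diagonal value of the
  -- covariance form.
  have h := DFunLike.congr_fun (DFunLike.congr_fun
    (covarianceBilin_multivariateGaussian_covariance 0 hξ)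
    ((InnerProductSpace.toDual ℝ _).symm ℓ)) ((InnerProductSpace.toDual ℝ _).symm ℓ)
  rw [covarianceBilin_self IsGaussian.memLp_two_id,
    covarianceBilin_self ((memLp_map_measure_iff (by fun_prop) hm).2 hξ)] at h
  simp only [InnerProductSpace.toDual_symm_apply] at h
  rw [h, variance_map (by fun_prop) hm]
  rfl

lemma hasLaw_sub_multivariateGaussian {Ω : Type*} [MeasurableSpace Ω] {P : Measure Ω}
    {m : EuclideanSpace ℝ ι} {S : Matrix ι ι ℝ} {Y : Ω → EuclideanSpace ℝ ι}
    (hY : HasLaw Y (multivariateGaussian m S) P) :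
    HasLaw (fun ω => Y ω - m) (multivariateGaussian 0 S) P := by
  refine HasLaw.comp (Y := fun y => y - m) ⟨by fun_prop, ?_⟩ hY
  rw [multivariateGaussian, multivariateGaussian, Measure.map_map (by fun_prop) (by fun_prop)]
  congr 1
  ext1 x
  simp

lemma hasDerivAt_fisherZ {x : ℝ} (hx : x ∈ Set.Ioo (-1 : ℝ) 1) :
    HasDerivAt fisherZ (1 / (1 - x ^ 2)) x := by
  have h1 : 0 < 1 + x := by linarith [hx.1]
  have h2 : 0 < 1 - x := by linarith [hx.2]
  have h3 : HasDerivAt (fun y : ℝ => (1 + y) / (1 - y)) (2 / (1 - x) ^ 2) x := by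
    convert! ((hasDerivAt_id x).const_add 1).div ((hasDerivAt_id x).const_sub 1) h2.ne' using 1
    simp only [id]
    ring
  convert! (h3.log (div_pos h1 h2).ne').const_mul (1 / 2) using 1
  have : 1 - x ^ 2 = (1 + x) * (1 - x) := by ring
  rw [this]
  field_simp

lemma exists_hasFDerivAt_fisherZVec {ρ : EuclideanSpace ℝ κ}
    (hρ : ∀ a, ρ a ∈ Set.Ioo (-1 : ℝ) 1) :
    ∃ L : EuclideanSpace ℝ κ →L[ℝ] EuclideanSpace ℝ κ, HasFDerivAt fisherZVec L ρ ∧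
      ∀ x a, L x a = 1 / (1 - ρ a ^ 2) * x a := by
  have h : ∀ a, HasFDerivAt (fun x : EuclideanSpace ℝ κ => fisherZ (x a))
      ((1 / (1 - ρ a ^ 2)) • coord a) ρ := fun a =>
    HasDerivAt.comp_hasFDerivAt (h₂ := fisherZ) ρ (hasDerivAt_fisherZ (hρ a))
      (coord a).hasFDerivAt
  exact ⟨_, hasFDerivAt_toLp h, fun _ _ => rfl⟩

/-- The `z`-transform turns an asymptotic covariance matrix with diagonal entries
`(1 - ρ a ^ 2) ^ 2` into its correlation matrix. -/
lemma isAsymptoticCov_fisherZVec {Ω : Type*} [MeasurableSpace Ω] {P : Measure Ω}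
    [IsProbabilityMeasure P] {r : ℕ → Ω → EuclideanSpace ℝ ι} {ρ : EuclideanSpace ℝ ι}
    {W : Matrix ι ι ℝ} (hρ : ∀ a, ρ a ∈ Set.Ioo (-1 : ℝ) 1)
    (hW : IsAsymptoticCov P r ρ W) (hdiag : ∀ a, W a a = (1 - ρ a ^ 2) ^ 2)
    (hrm : ∀ n, AEMeasurable (r n) P)
    (hlim : ∀ᵐ ω ∂P, Tendsto (fun n => r n ω) atTop (𝓝 ρ)) :
    IsAsymptoticCov P (fun n ω => fisherZVec (r n ω)) (fisherZVec ρ) (corrMatrix W) := by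
  obtain ⟨L, hL, hLx⟩ := exists_hasFDerivAt_fisherZVec hρ
  have h := hW.comp hrm hlim measurable_fisherZVec hL
  convert h using 1
  ext a b
  have hpos : ∀ a, 0 < 1 - ρ a ^ 2 := fun a => by nlinarith [(hρ a).1, (hρ a).2]
  simp only [corrMatrix, Matrix.of_apply, hLx, covariance_const_mul_left,
    covariance_const_mul_right, covariance_eval_multivariateGaussian hW.1, hdiag]
  -- The standard deviations `1 - ρ a ^ 2` are positive, so the root in the correlation matrix is
  -- their product, matching the two derivative factors.
  rw [← mul_pow, Real.sqrt_sq (mul_pos (hpos a) (hpos b)).le]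
  have ha := (hpos a).ne'
  have hb := (hpos b).ne'
  field_simp

variable {p : ℕ}

lemma exists_hasFDerivAt_partialCorrVec {S : Matrix (Fin p) (Fin p) ℝ} (hS : S.PosDef)
    (C : Pair p → Finset (Fin p)) :
    ∃ L : EuclideanSpace ℝ ((Fin p × Fin p) ⊕ Fin p) →L[ℝ] EuclideanSpace ℝ (Pair p),
      HasFDerivAt (fun t => partialCorrVec (covOfMoments t) C) L (centeredMoments S) ∧
      ∀ {Ω : Type*} [MeasurableSpace Ω] {P : Measure Ω} [IsProbabilityMeasure P]
        {X : Ω → EuclideanSpace ℝ (Fin p)} (_ : HasLaw X (multivariateGaussian 0 S) P) (a : Pair p),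
        Var[fun ω => coord a (L (momentVec (X ω))); P] = (1 - partialCorrVec S C a ^ 2) ^ 2 := by
  choose L hL hLx using fun a : Pair p => exists_hasFDerivAt_partialCorr hS (C a) a.1.1 a.1.2
  exact ⟨_, hasFDerivAt_toLp hL, fun hX a =>
    variance_linearized_partialCorr hS hX (C a) a.1.1 a.1.2 (hLx a)⟩

lemma measurable_partialCorrVec_covOfMoments (C : Pair p → Finset (Fin p)) :
    Measurable fun t => partialCorrVec (covOfMoments t) C :=
  (WithLp.measurable_toLp 2 _).comp
    (measurable_pi_lambda _ fun _ => measurable_partialCorr_covOfMoments _ _ _)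

end Assembly

end GaussianPartialCorr

theorem proposition5 {p : ℕ} (μ : EuclideanSpace ℝ (Fin p)) (S : Matrix (Fin p) (Fin p) ℝ)
    (hS : S.PosDef) (C : Pair p → Finset (Fin p))
    (hC : ∀ a : Pair p, a.1.1 ∉ C a ∧ a.1.2 ∉ C a)
    {Ω : Type*} [MeasurableSpace Ω] (P : Measure Ω) [IsProbabilityMeasure P]
    (Y : ℕ → Ω → EuclideanSpace ℝ (Fin p))
    (hindep : iIndepFun Y P) (hlaw : ∀ m, HasLaw (Y m) (multivariateGaussian μ S) P) :
    let ρ : EuclideanSpace ℝ (Pair p) := partialCorrVec S C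
    let r : ℕ → Ω → EuclideanSpace ℝ (Pair p) := fun n ω =>
      partialCorrVec (sampleCov n fun m => Y m ω) C
    let z : ℕ → Ω → EuclideanSpace ℝ (Pair p) := fun n ω => fisherZVec (r n ω)
    ∃ W : Matrix (Pair p) (Pair p) ℝ,
      (∀ A, IsAsymptoticCov P r ρ A ↔ A = W) ∧
      (∀ a, ρ a ∈ Set.Ioo (-1 : ℝ) 1 ∧ W a a = (1 - ρ a ^ 2) ^ 2) ∧
      (∀ B, IsAsymptoticCov P z (fisherZVec ρ) B ↔ B = corrMatrix W) := by
  intro ρ r z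
  have hX := fun m => hasLaw_sub_multivariateGaussian (hlaw m)
  set ξ : ℕ → Ω → EuclideanSpace ℝ ((Fin p × Fin p) ⊕ Fin p) :=
    fun k ω => momentVec (Y k ω - μ) with hξdef
  have hcomp : Measurable fun y : EuclideanSpace ℝ (Fin p) => momentVec (y - μ) :=
    measurable_momentVec.comp (by fun_prop)
  have hind : iIndepFun ξ P := hindep.comp (fun _ y => momentVec (y - μ)) fun _ => hcomp
  have hid : ∀ i, IdentDistrib (ξ i) (ξ 0) P P := fun i =>
    ((hlaw i).identDistrib (hlaw 0)).comp hcomp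
  have hL2 : MemLp (ξ 0) 2 P := memLp_momentVec (hX 0)
  have hmean : ∫ ω, ξ 0 ω ∂P = centeredMoments S := integral_momentVec hS (hX 0)
  set T : ℕ → Ω → EuclideanSpace ℝ ((Fin p × Fin p) ⊕ Fin p) :=
    fun n ω => (n : ℝ)⁻¹ • ∑ k ∈ Finset.range n, ξ k ω with hTdef
  have hξm : ∀ k, AEMeasurable (ξ k) P := fun k => (hid k).aemeasurable_fst
  have hTm : ∀ n, AEMeasurable (T n) P := fun n => by
    simp only [hTdef]
    fun_prop
  have hT := isAsymptoticCov_mean hind hid hL2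
  -- Almost sure consistency is what the delta method needs to make its remainder negligible.
  have hTlim := strong_law_ae ξ (hL2.integrable (by simp))
    (fun i j hij => hind.indepFun hij) hid
  rw [hmean] at hT hTlim
  obtain ⟨L, hL, hLvar⟩ := exists_hasFDerivAt_partialCorrVec hS C
  have hrT : ∀ n ω, r n ω = partialCorrVec (covOfMoments (T n ω)) C := fun n ω => by
    ext a
    exact partialCorr_sampleCov n (fun m => Y m ω) μ (C a) a.1.1 a.1.2
  have hfm := measurable_partialCorrVec_covOfMoments C
  have hρ : partialCorrVec (covOfMoments (centeredMoments S)) C = ρ := by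
    rw [covOfMoments_centeredMoments]
  have hW := hT.comp hTm hTlim hfm hL
  have hr : (fun n ω => partialCorrVec (covOfMoments (T n ω)) C) = r := by
    ext1 n
    ext1 ω
    exact (hrT n ω).symm
  rw [hρ] at hW
  change IsAsymptoticCov P (fun n ω => partialCorrVec (covOfMoments (T n ω)) C) ρ _ at hW
  have hrm : ∀ n, AEMeasurable (r n) P := fun n => by
    rw [← hr]
    exact hfm.comp_aemeasurable (hTm n)
  have hrlim : ∀ᵐ ω ∂P, Tendsto (fun n => r n ω) atTop (𝓝 ρ) := by
    filter_upwards [hTlim] with ω hω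
    have := hL.continuousAt.tendsto.comp hω
    rw [hρ] at this
    refine this.congr fun n => (hrT n ω).symm
  rw [hr] at hW
  have hmem : ∀ a, ρ a ∈ Set.Ioo (-1 : ℝ) 1 := fun a => partialCorr_mem_Ioo hS (C a) a.2.ne
  have hdiag : ∀ a, (Matrix.of fun a b => cov[fun x => L x a, fun x => L x b;
      multivariateGaussian 0 (Matrix.of fun i j => cov[fun ω => ξ 0 ω i, fun ω => ξ 0 ω j; P])])
      a a = (1 - ρ a ^ 2) ^ 2 := fun a => by
    rw [Matrix.of_apply, covariance_self (by fun_prop)]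
    -- The variance under the Gaussian limit equals the variance under the law of one observation,
    -- where the residual computation applies.
    exact (variance_clm_multivariateGaussian_covariance hL2 (coord a ∘L L)).trans
      (hLvar (hX 0) a)
  exact ⟨_, hW.iff_eq, fun a => ⟨hmem a, hdiag a⟩,
    (isAsymptoticCov_fisherZVec hmem hW hdiag hrm hrlim).iff_eq⟩
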